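/- Let $\mathbb{T}^\star\subseteq\mathbb{R}$ be a time scale (a nonempty closed set) with jump operators $\hat\sigma,\hat\rho$ (where $\hat\sigma(\max\mathbb{T}^\star)=\max\mathbb{T}^\star$ and $\hat\rho(\min\mathbb{T}^\star)=\min\mathbb{T}^\star$ when these exist), and let $(\mathbb{T}^\star)_\kappa$ be $\mathbb{T}^\star$ with its minimum removed if that minimum is right-scattered. Let $\mathbb{T}=\{t: -t\in\mathbb{T}^\star\}$ be the dual time scale, and let $\mathbb{T}^\kappa$ be $\mathbb{T}$ with its maximum removed if that maximum is left-scattered. Let $s_0\in\mathbb{T}^\star$, $t_0=-s_0$, $y_0\in\mathbb{R}^n$, and let $\bar A:(\mathbb{T}^\star)_\kappa\to\mathbb{R}^{n\times n}$ be ld-continuous, i.e. continuous at every left-dense point ($\hat\rho(s)=s$) and with finite right-sided limit at every right-dense point ($\hat\sigma(s)=s$). Put $A(t)=-\bar A^\star(t)=-\bar A(-t)$ for $t\in\mathbb{T}^\kappa$. (a) The matrix system $X^\Delta(t)=A(t)X(t)$ for $t\in\mathbb{T}^\kappa$, $t\ge t_0$, with $X(t_0)=I$, has exactly one forward solution on $[t_0,\infty)\cap\mathbb{T}$.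 Denote its value at $t$ by $\Phi_A(t,t_0)$ (the transition function). (b) The system $$y^{\hat\nabla}(s)=\bar A(s)y(s)\quad (s\in(\mathbb{T}^\star)_\kappa,\ s\le s_0),\qquad y(s_0)=y_0,$$ has exactly one backward solution, i.e. exactly one solution $y:(-\infty,s_0]\cap\mathbb{T}^\star\to\mathbb{R}^n$, and it is $$y(s)=\Psi_{\bar A}(s,s_0)\,y_0\qquad (s\in\mathbb{T}^\star,\ s\le s_0),$$ where $\Psi_{\bar A}(s,s_0)=\Phi_{-\bar A^\star}(-s,-s_0)$ is the transition function dual to $\Phi$. Here the delta and nabla derivatives of a function on $[t_0,\infty)\cap\mathbb{T}$, respectively on $(-\infty,s_0]\cap\mathbb{T}^\star$, are taken entrywise on that time scale. -/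

import Mathlib

open Set Filter Topology

noncomputable section

namespace TScale

/-- A time scale is a nonempty closed subset of the real line. -/
def IsTimeScale (T : Set ℝ) : Prop := T.Nonempty ∧ IsClosed T

open Classical in
/-- Forward jump operator `σ(t) = inf {s ∈ T : s > t}`, with `σ(t) = t` if `t` is the maximum
of `T`. -/
def sigma (T : Set ℝ) (t : ℝ) : ℝ :=
  if (T ∩ Ioi t).Nonempty then sInf (T ∩ Ioi t) else t

open Classical in
/-- Backward jump operator `ρ(t) = sup {s ∈ T : s < t}`, with `ρ(t) = t` if `t` is the minimum
of `T`. -/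
def rho (T : Set ℝ) (t : ℝ) : ℝ :=
  if (T ∩ Iio t).Nonempty then sSup (T ∩ Iio t) else t

/-- `T^κ`: the time scale `T` without its maximum if that maximum is left-scattered. -/
def upperKappa (T : Set ℝ) : Set ℝ := {t ∈ T | ¬ (IsGreatest T t ∧ rho T t < t)}

/-- `T_κ`: the time scale `T` without its minimum if that minimum is right-scattered. -/
def lowerKappa (T : Set ℝ) : Set ℝ := {t ∈ T | ¬ (IsLeast T t ∧ t < sigma T t)}

/-- `f : T → ℝ` is delta differentiable at `t ∈ T` with delta derivative `a`. Only the values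
of `f` on `T` matter. -/
def HasDeltaDeriv (T : Set ℝ) (f : ℝ → ℝ) (a t : ℝ) : Prop :=
  ∀ ε > 0, ∃ δ > 0, ∀ s ∈ T, |s - t| < δ →
    |f (sigma T t) - f s - a * (sigma T t - s)| ≤ ε * |sigma T t - s|

/-- `f : T → ℝ` is nabla differentiable at `t ∈ T` with nabla derivative `a`. Only the values
of `f` on `T` matter. -/
def HasNablaDeriv (T : Set ℝ) (f : ℝ → ℝ) (a t : ℝ) : Prop :=
  ∀ ε > 0, ∃ δ > 0, ∀ s ∈ T, |s - t| < δ →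
    |f (rho T t) - f s - a * (rho T t - s)| ≤ ε * |rho T t - s|

/-- A function `f` defined on `T_κ` is ld-continuous: it is continuous at the left-dense points
(those with `ρ(s) = s`) and has finite right-sided limits at the right-dense points (those with
`σ(s) = s`; at the maximum of `T` the right-sided limit is vacuous). -/
def IsLdContinuous {E : Type*} [TopologicalSpace E] (T : Set ℝ) (f : ℝ → E) : Prop :=
  ∀ s ∈ lowerKappa T,
    (rho T s = s → ContinuousWithinAt f (lowerKappa T) s) ∧
    (sigma T s = s → ∃ l : E, Tendsto f (𝓝[lowerKappa T ∩ Ioi s] s) (𝓝 l))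

/-- The dual time scale `T⋆ = {s : -s ∈ T}`. -/
def dual (T : Set ℝ) : Set ℝ := {s | -s ∈ T}

/-- The dual function `f⋆(s) = f(-s)`. -/
def dualFun {E : Type*} (f : ℝ → E) : ℝ → E := fun s => f (-s)

/-- `X` is a forward solution of the matrix system `X^Δ(t) = A(t) X(t)`, `X(t₀) = I`, that is,
a function on the time scale `[t₀, ∞) ∩ T` which satisfies the equation, entry by entry, at all
`t ∈ T^κ` with `t ≥ t₀`. -/
def IsForwardFundamental {n : ℕ} (T : Set ℝ) (A : ℝ → Matrix (Fin n) (Fin n) ℝ) (t₀ : ℝ)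
    (X : ℝ → Matrix (Fin n) (Fin n) ℝ) : Prop :=
  X t₀ = 1 ∧ ∀ t ∈ upperKappa T, t₀ ≤ t → ∀ i j,
    HasDeltaDeriv (T ∩ Ici t₀) (fun τ => X τ i j) ((A t * X t) i j) t

/-- The transition function `Φ_A(t, t₀)` of `x^Δ = A x` on `T`: the value at `t ≥ t₀` of the
forward solution of `X^Δ = A X`, `X(t₀) = I`. -/
def transition {n : ℕ} (T : Set ℝ) (A : ℝ → Matrix (Fin n) (Fin n) ℝ) (t t₀ : ℝ) :
    Matrix (Fin n) (Fin n) ℝ :=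
  Classical.epsilon (IsForwardFundamental T A t₀) t

/-- The dual transition function on the time scale `S`:
`Ψ_B(s, s₀) = Φ_{-B⋆}(-s, -s₀)`, where `Φ` is taken on the dual time scale of `S`. -/
def dualTransition {n : ℕ} (S : Set ℝ) (B : ℝ → Matrix (Fin n) (Fin n) ℝ) (s s₀ : ℝ) :
    Matrix (Fin n) (Fin n) ℝ :=
  transition (dual S) (-dualFun B) (-s) (-s₀)

/-- `y` is a backward solution of `y^∇(s) = B(s) y(s)`, `y(s₀) = y₀`, on the time scale `S`,
that is, a function on the time scale `(-∞, s₀] ∩ S` which satisfies the equation,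
coordinate by coordinate, at all `s ∈ S_κ` with `s ≤ s₀`. -/
def IsBackwardSolution {n : ℕ} (S : Set ℝ) (B : ℝ → Matrix (Fin n) (Fin n) ℝ) (s₀ : ℝ)
    (y₀ : Fin n → ℝ) (y : ℝ → Fin n → ℝ) : Prop :=
  y s₀ = y₀ ∧ ∀ s ∈ lowerKappa S, s ≤ s₀ → ∀ i,
    HasNablaDeriv (S ∩ Iic s₀) (fun r => y r i) ((B s).mulVec (y s) i) s

end TScale

end

/-! The reflection `t ↦ -t` exchanges forward and backward jumps, turns nabla derivatives into delta
derivatives with opposite sign, and turns left-dense points into right-dense ones. Both systems thus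
become the linear delta equation `x^Δ(t) = A(-t) x(t)` on the part of the dual time scale from `-s₀`
on, with `A` operator-valued on a Banach space: left multiplication on matrices, or the action on
vectors. Uniqueness (`eq_zero_of_hasDeltaDerivVec`) is a Grönwall estimate proved by induction along
the time scale. Existence (`exists_hasDeltaDerivVec`) passes to the real line: with `p v` the last
point of the time scale up to `v`, solve `x(t) = x₀ + ∫ A(p v) x(p v) dv` by a Picard series. The
integrand is constant on gaps, which gives the jump at right-scattered points; at right-dense points
continuity of the coefficient gives the derivative. Finally, applying the matrix solution to `y₀`
gives a solution of the vector system, and uniqueness does the rest. -/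

open MeasureTheory

namespace TScale

/-! ### Delta calculus for vector-valued functions -/

section general

variable {E : Type*} [NormedAddCommGroup E] [NormedSpace ℝ E]

/-- Delta differentiability of a vector-valued function. -/
def HasDeltaDerivVec (T : Set ℝ) (f : ℝ → E) (a : E) (t : ℝ) : Prop :=
  ∀ ε > 0, ∃ δ > 0, ∀ s ∈ T, |s - t| < δ →
    ‖f (sigma T t) - f s - (sigma T t - s) • a‖ ≤ ε * |sigma T t - s|

lemma le_sigma (T : Set ℝ) (t : ℝ) : t ≤ sigma T t := by
  unfold sigma
  split_ifs with h
  · exact le_csInf h fun s hs => hs.2.le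
  · exact le_rfl

lemma sigma_le {T : Set ℝ} {s t : ℝ} (hs : s ∈ T) (hts : t < s) : sigma T t ≤ s := by
  have h : (T ∩ Ioi t).Nonempty := ⟨s, hs, hts⟩
  rw [sigma, if_pos h]
  exact csInf_le ⟨t, fun r hr => hr.2.le⟩ ⟨hs, hts⟩

lemma sigma_mem {T : Set ℝ} (hT : IsClosed T) {t : ℝ} (ht : t ∈ T) : sigma T t ∈ T := by
  by_cases h : (T ∩ Ioi t).Nonempty
  · rw [sigma, if_pos h]
    have hb : BddBelow (T ∩ Ioi t) := ⟨t, fun r hr => hr.2.le⟩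
    exact hT.closure_subset_iff.2 inter_subset_left (csInf_mem_closure h hb)
  · rwa [sigma, if_neg h]

lemma sigma_eq_of_gap {T : Set ℝ} {r c : ℝ} (hc : c ∈ T) (hrc : r < c)
    (hgap : ∀ s ∈ T, r < s → c ≤ s) : sigma T r = c := by
  refine le_antisymm (sigma_le hc hrc) ?_
  have h : (T ∩ Ioi r).Nonempty := ⟨c, hc, hrc⟩
  rw [sigma, if_pos h]
  exact le_csInf h fun s hs => hgap s hs.1 hs.2

lemma sigma_neg_dual (T : Set ℝ) (t : ℝ) : sigma (dual T) (-t) = -rho T t := by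
  have he : dual T ∩ Ioi (-t) = -(T ∩ Iio t) := by
    ext s
    simp only [dual, mem_inter_iff, mem_ofPred_eq, mem_Ioi, Set.mem_neg, mem_Iio]
    exact and_congr_right fun _ => neg_lt
  unfold sigma rho
  rw [he]
  by_cases h : (T ∩ Iio t).Nonempty
  · rw [if_pos h, if_pos h.neg, Real.sInf_def, neg_neg]
  · rw [if_neg h, if_neg (by rwa [Set.nonempty_neg])]

lemma rho_neg_dual (T : Set ℝ) (t : ℝ) : rho (dual T) (-t) = -sigma T t := by
  have hd : dual (dual T) = T := by ext s; simp [dual]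
  have := sigma_neg_dual (dual T) (-t)
  rw [hd, neg_neg] at this
  rw [this, neg_neg]

lemma sigma_inter_Ici (T : Set ℝ) {t₀ t : ℝ} (ht : t₀ ≤ t) :
    sigma (T ∩ Ici t₀) t = sigma T t := by
  have he : T ∩ Ici t₀ ∩ Ioi t = T ∩ Ioi t := by
    ext s
    simp only [mem_inter_iff, mem_Ici, mem_Ioi]
    exact ⟨fun h => ⟨h.1.1, h.2⟩, fun h => ⟨⟨h.1, ht.trans h.2.le⟩, h.2⟩⟩
  unfold sigma
  rw [he]

lemma HasDeltaDerivVec.continuousWithinAt {T : Set ℝ} {f : ℝ → E} {a : E} {t : ℝ} (ht : t ∈ T)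
    (h : HasDeltaDerivVec T f a t) : ContinuousWithinAt f T t := by
  set σ := sigma T t with hσ
  -- the limit of `f s` is `f σ - (σ - t) • a`, which is `f t`
  have key : Tendsto (fun s => f σ - f s - (σ - s) • a) (𝓝[T] t)
      (𝓝 (f σ - f t - (σ - t) • a)) := by
    have hz : f σ - f t - (σ - t) • a = 0 := by
      refine norm_le_zero_iff.1 (le_of_forall_pos_le_add fun ε hε => ?_)
      have hd : 0 < |σ - t| + 1 := by positivity
      obtain ⟨δ, hδ, H⟩ := h (ε / (|σ - t| + 1)) (by positivity)
      refine (H t ht (by simpa using hδ)).trans ?_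
      rw [zero_add, div_mul_eq_mul_div, div_le_iff₀ hd]
      nlinarith
    rw [hz, Metric.tendsto_nhdsWithin_nhds]
    intro ε hε
    have hd : 0 < |σ - t| + 1 := by positivity
    obtain ⟨δ, hδ, H⟩ := h (ε / 2 / (|σ - t| + 1)) (by positivity)
    refine ⟨min δ 1, by positivity, fun s hs hst => ?_⟩
    rw [Real.dist_eq] at hst
    rw [dist_zero_right]
    refine (H s hs (hst.trans_le (min_le_left _ _))).trans_lt ?_
    have h1 : |σ - s| ≤ |σ - t| + 1 := by
      have := abs_sub_le σ t s
      have h2 := hst.trans_le (min_le_right _ _)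
      rw [abs_sub_comm] at h2
      linarith
    rw [div_mul_eq_mul_div, div_lt_iff₀ hd]
    nlinarith
  have h2 : Tendsto (fun s => f σ - (σ - s) • a - (f σ - f s - (σ - s) • a)) (𝓝[T] t)
      (𝓝 (f σ - (σ - t) • a - (f σ - f t - (σ - t) • a))) := by
    refine Tendsto.sub ?_ key
    refine tendsto_const_nhds.sub (Tendsto.smul_const ?_ a)
    exact (tendsto_const_nhds.sub tendsto_id).mono_left nhdsWithin_le_nhds
  unfold ContinuousWithinAt
  convert h2 using 2 <;> simp

/-- The point `s = t` lies in every neighbourhood of `t`, so the defining estimate holds there for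
every `ε`. -/
lemma HasDeltaDerivVec.sigma_eq {T : Set ℝ} {f : ℝ → E} {a : E} {t : ℝ} (ht : t ∈ T)
    (h : HasDeltaDerivVec T f a t) : f (sigma T t) = f t + (sigma T t - t) • a := by
  have hz : f (sigma T t) - f t - (sigma T t - t) • a = 0 := by
    refine norm_le_zero_iff.1 (le_of_forall_pos_le_add fun ε hε => ?_)
    -- The `+ 1` keeps the divisor positive when `t` is right-dense.
    have hd : 0 < |sigma T t - t| + 1 := by positivity
    obtain ⟨δ, hδ, H⟩ := h (ε / (|sigma T t - t| + 1)) (by positivity)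
    refine (H t ht (by simpa using hδ)).trans ?_
    rw [zero_add, div_mul_eq_mul_div, div_le_iff₀ hd]
    nlinarith
  rw [sub_sub, sub_eq_zero] at hz
  exact hz

lemma HasDeltaDerivVec.sub {T : Set ℝ} {f g : ℝ → E} {a b : E} {t : ℝ}
    (hf : HasDeltaDerivVec T f a t) (hg : HasDeltaDerivVec T g b t) :
    HasDeltaDerivVec T (fun s => f s - g s) (a - b) t := by
  intro ε hε
  obtain ⟨δ₁, h₁, H₁⟩ := hf (ε / 2) (by positivity)
  obtain ⟨δ₂, h₂, H₂⟩ := hg (ε / 2) (by positivity)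
  refine ⟨min δ₁ δ₂, lt_min h₁ h₂, fun s hs hst => ?_⟩
  have e1 := H₁ s hs (hst.trans_le (min_le_left _ _))
  have e2 := H₂ s hs (hst.trans_le (min_le_right _ _))
  have e3 := norm_sub_le (f (sigma T t) - f s - (sigma T t - s) • a)
    (g (sigma T t) - g s - (sigma T t - s) • b)
  have e4 : f (sigma T t) - g (sigma T t) - (f s - g s) - (sigma T t - s) • (a - b) =
      (f (sigma T t) - f s - (sigma T t - s) • a) -
        (g (sigma T t) - g s - (sigma T t - s) • b) := by
    rw [smul_sub]; abel
  rw [e4]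
  linarith

/-! ### Induction on a time scale and uniqueness -/

/-- Induction along a time scale with least element `t₀`. -/
lemma timeScale_induction {T : Set ℝ} (hT : IsClosed T) {t₀ : ℝ} (h₀ : IsLeast T t₀)
    {P : ℝ → Prop} (base : P t₀)
    (scattered : ∀ t ∈ T, P t → P (sigma T t))
    (rightDense : ∀ t ∈ T, sigma T t = t → P t → ∃ δ > 0, ∀ s ∈ T, t < s → s < t + δ → P s)
    (leftDense : ∀ t ∈ T, (∀ s ∈ T, s < t → P s) → (∀ δ > 0, ∃ s ∈ T, t - δ < s ∧ s < t) → P t)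
    {t : ℝ} (ht : t ∈ T) : P t := by
  by_contra hPt
  set F := {s ∈ T | ¬ P s} with hF
  have hne : F.Nonempty := ⟨t, ht, hPt⟩
  have hbd : BddBelow F := ⟨t₀, fun s hs => h₀.2 hs.1⟩
  -- First `P c` is shown for the infimum `c` of the counterexamples; then counterexamples can
  -- neither accumulate at `c` from the right nor start beyond a gap.
  set c := sInf F
  have hcT : c ∈ T := hT.closure_subset_iff.2 (fun s hs => hs.1) (csInf_mem_closure hne hbd)
  have hlt : ∀ s ∈ T, s < c → P s := fun s hs hsc => by
    by_contra hn
    exact absurd (csInf_le hbd ⟨hs, hn⟩) (not_le.2 hsc)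
  have hPc : P c := by
    by_cases hd : ∀ δ > 0, ∃ s ∈ T, c - δ < s ∧ s < c
    · exact leftDense c hcT hlt hd
    · push Not at hd
      obtain ⟨δ, hδ, H⟩ := hd
      rcases (h₀.2 hcT).eq_or_lt with he | hl
      · rwa [← he]
      have hne' : (T ∩ Iic (c - δ)).Nonempty := by
        refine ⟨t₀, h₀.1, ?_⟩
        by_contra hn
        exact absurd (H t₀ h₀.1 (not_le.1 hn)) (not_le.2 hl)
      have hbd' : BddAbove (T ∩ Iic (c - δ)) := ⟨c - δ, fun s hs => hs.2⟩
      have hr := (hT.inter isClosed_Iic).csSup_mem hne' hbd'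
      -- `r` is the left neighbour of `c`, so `c = sigma T r` and the scattered step applies.
      set r := sSup (T ∩ Iic (c - δ))
      have hrc : r < c := lt_of_le_of_lt hr.2 (by linarith)
      have hs : sigma T r = c := by
        refine sigma_eq_of_gap hcT hrc fun s hsT hrs => ?_
        by_contra hn
        rcases le_or_gt s (c - δ) with h1 | h1
        · exact absurd (le_csSup hbd' ⟨hsT, h1⟩) (not_le.2 hrs)
        · exact hn (H s hsT h1)
      rw [← hs]
      exact scattered r hr.1 (hlt r hr.1 hrc)
  by_cases hσ : sigma T c = c
  · obtain ⟨δ, hδ, H⟩ := rightDense c hcT hσ hPc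
    obtain ⟨s, hs, hsc⟩ := exists_lt_of_csInf_lt hne (show c < c + δ by linarith)
    rcases (csInf_le hbd hs).eq_or_lt with he | hl
    · exact hs.2 (he ▸ hPc)
    · exact hs.2 (H s hs.1 hl hsc)
  · have hl : c < sigma T c := lt_of_le_of_ne (le_sigma T c) (Ne.symm hσ)
    obtain ⟨s, hs, hsc⟩ := exists_lt_of_csInf_lt hne hl
    rcases (csInf_le hbd hs).eq_or_lt with he | hl'
    · exact hs.2 (he ▸ hPc)
    · exact absurd (sigma_le hs.1 hl') (not_le.2 hsc)

/-- Compactness of `T ∩ Icc a b` makes local bounds uniform. -/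
lemma exists_bound_of_locally_bounded {F : Type*} [SeminormedAddCommGroup F] {T : Set ℝ}
    (hT : IsClosed T) {A : ℝ → F}
    (hA : ∀ t ∈ T, ∃ K, ∀ᶠ s in 𝓝[T] t, ‖A s‖ ≤ K) (a b : ℝ) :
    ∃ K, 0 ≤ K ∧ ∀ t ∈ T, t ∈ Icc a b → ‖A t‖ ≤ K := by
  have hc : IsCompact (T ∩ Icc a b) := isCompact_Icc.inter_left hT
  have := hc.induction_on (p := fun S => ∃ K, 0 ≤ K ∧ ∀ t ∈ S, t ∈ T → ‖A t‖ ≤ K)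
    ⟨0, le_rfl, by simp⟩ (fun S S' h ⟨K, h0, hK⟩ => ⟨K, h0, fun t ht => hK t (h ht)⟩)
    (fun S S' ⟨K, h0, hK⟩ ⟨K', h0', hK'⟩ => ⟨max K K', h0.trans (le_max_left _ _), fun t ht htT =>
      ht.elim (fun h => (hK t h htT).trans (le_max_left _ _))
        (fun h => (hK' t h htT).trans (le_max_right _ _))⟩)
    (fun t ht => by
      obtain ⟨K, hK⟩ := hA t ht.1
      refine ⟨{s | s ∈ T → ‖A s‖ ≤ K}, mem_nhdsWithin_of_mem_nhds (eventually_nhdsWithin_iff.1 hK),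
        max K 0, le_max_right _ _, fun s hs hsT => (hs hsT).trans (le_max_left _ _)⟩)
  obtain ⟨K, h0, hK⟩ := this
  exact ⟨K, h0, fun t ht htab => hK t ⟨ht, htab⟩ ht⟩

/-- A solution of a homogeneous linear delta equation which vanishes at the initial point
vanishes. -/
lemma eq_zero_of_hasDeltaDerivVec {T : Set ℝ} (hT : IsClosed T) {t₀ : ℝ} (h₀ : IsLeast T t₀)
    {A : ℝ → E →L[ℝ] E} (hA : ∀ t ∈ T, ∃ K, ∀ᶠ s in 𝓝[T] t, ‖A s‖ ≤ K)
    {z : ℝ → E} (hz₀ : z t₀ = 0) (hz : ∀ t ∈ T, HasDeltaDerivVec T z (A t (z t)) t)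
    {b : ℝ} (hb : b ∈ T) : z b = 0 := by
  obtain ⟨K, hK0, hK⟩ := exists_bound_of_locally_bounded hT hA t₀ b
  have bound : ∀ t ∈ T, t ≤ b → ∀ w, ‖z t‖ ≤ w → ‖A t (z t)‖ ≤ K * w := fun t ht htb w hw =>
    ((A t).le_opNorm _).trans
      (mul_le_mul (hK t ht ⟨h₀.2 ht, htb⟩) hw (norm_nonneg _) hK0)
  -- Grönwall majorant. The rate is `K + 1` rather than `K` so that the spare `1` absorbs the
  -- differentiation error at right-dense points; `1 + x ≤ exp x` closes both forward steps.
  have key : ∀ ε > 0, ∀ t ∈ T, t ≤ b → ‖z t‖ ≤ ε * Real.exp ((K + 1) * (t - t₀)) := by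
    intro ε hε t ht
    refine timeScale_induction hT h₀
      (P := fun t => t ≤ b → ‖z t‖ ≤ ε * Real.exp ((K + 1) * (t - t₀))) ?_ ?_ ?_ ?_ ht
    · intro _
      rw [hz₀, norm_zero]; positivity
    · intro t ht IH hσb
      have htσ := le_sigma T t
      have IH := IH (htσ.trans hσb)
      rw [(hz t ht).sigma_eq ht]
      set w := ε * Real.exp ((K + 1) * (t - t₀))
      have hw : 0 < w := by positivity
      have e1 : ‖z t + (sigma T t - t) • A t (z t)‖ ≤ w + (sigma T t - t) * (K * w) := by
        refine (norm_add_le _ _).trans (add_le_add IH ?_)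
        rw [norm_smul, Real.norm_of_nonneg (by linarith)]
        exact mul_le_mul_of_nonneg_left (bound t ht (htσ.trans hσb) w IH) (by linarith)
      refine e1.trans ?_
      have e2 : ε * Real.exp ((K + 1) * (sigma T t - t₀)) =
          w * Real.exp ((K + 1) * (sigma T t - t)) := by
        rw [mul_assoc, ← Real.exp_add]; ring_nf
      rw [e2]
      have e3 := Real.add_one_le_exp ((K + 1) * (sigma T t - t))
      nlinarith [mul_le_mul_of_nonneg_left e3 hw.le, mul_nonneg hw.le (sub_nonneg.2 htσ)]
    · intro t ht hσ IH
      set w := ε * Real.exp ((K + 1) * (t - t₀)) with hwdef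
      have hw : 0 < w := by positivity
      -- With tolerance `w`, the error is at most `w * (s - t)`, exactly what the spare `1` in the
      -- rate covers.
      obtain ⟨δ, hδ, H⟩ := hz t ht w hw
      refine ⟨δ, hδ, fun s hs hts hsδ hsb => ?_⟩
      have IH := IH (hts.le.trans hsb)
      have h1 := H s hs (by rw [abs_of_pos (by linarith)]; linarith)
      rw [hσ, abs_of_neg (show t - s < 0 by linarith)] at h1
      have h2 : z s = z t + (s - t) • A t (z t) - (z t - z s - (t - s) • A t (z t)) := by
        rw [← neg_sub t s, neg_smul]; abel
      have h3 : ‖z s‖ ≤ w + (s - t) * (K * w) + w * (s - t) := by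
        rw [h2]
        refine (norm_sub_le _ _).trans (add_le_add ((norm_add_le _ _).trans
          (add_le_add IH ?_)) (h1.trans_eq (by ring)))
        rw [norm_smul, Real.norm_of_nonneg (by linarith)]
        exact mul_le_mul_of_nonneg_left (bound t ht (hts.le.trans hsb) w IH) (by linarith)
      refine h3.trans ?_
      have e2 : ε * Real.exp ((K + 1) * (s - t₀)) = w * Real.exp ((K + 1) * (s - t)) := by
        rw [mul_assoc, ← Real.exp_add]; ring_nf
      rw [e2]
      have e3 := Real.add_one_le_exp ((K + 1) * (s - t))
      nlinarith [mul_le_mul_of_nonneg_left e3 hw.le]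
    · intro t ht IH hd htb
      have hcl : t ∈ closure (T ∩ Iio t) := Metric.mem_closure_iff.2 fun δ hδ => by
        obtain ⟨s, hs, h1, h2⟩ := hd δ hδ
        exact ⟨s, ⟨hs, h2⟩, by rw [Real.dist_eq, abs_of_pos] <;> linarith⟩
      have hne : (𝓝[T ∩ Iio t] t).NeBot := mem_closure_iff_nhdsWithin_neBot.1 hcl
      have hcont : Tendsto z (𝓝[T ∩ Iio t] t) (𝓝 (z t)) :=
        ((hz t ht).continuousWithinAt ht).mono inter_subset_left
      have hexp : Tendsto (fun s => ε * Real.exp ((K + 1) * (s - t₀))) (𝓝[T ∩ Iio t] t)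
          (𝓝 (ε * Real.exp ((K + 1) * (t - t₀)))) :=
        (Continuous.tendsto (by fun_prop) t).mono_left nhdsWithin_le_nhds
      refine le_of_tendsto_of_tendsto hcont.norm hexp ?_
      filter_upwards [self_mem_nhdsWithin] with s hs
      exact IH s hs.1 hs.2 (hs.2.le.trans htb)
  refine norm_le_zero_iff.1 (le_of_forall_pos_le_add fun ε hε => ?_)
  have := key (ε / Real.exp ((K + 1) * (b - t₀))) (by positivity) b hb le_rfl
  rwa [div_mul_cancel₀ _ (Real.exp_pos _).ne', ← zero_add ε] at this

/-! ### Existence through a Volterra equation on the real line -/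

lemma intervalIntegrable_delay {B : ℝ → E →L[ℝ] E} (hB : StronglyMeasurable B)
    (hbd : ∀ b, ∃ K, ∀ v ≤ b, ‖B v‖ ≤ K) {p : ℝ → ℝ} (hp : Monotone p) {x : ℝ → E}
    (hx : Continuous x) (u w : ℝ) :
    IntervalIntegrable (fun v => B v (x (p v))) volume u w := by
  have hm : StronglyMeasurable fun v => B v (x (p v)) :=
    isBoundedBilinearMap_apply.continuous.comp_stronglyMeasurable
      (hB.prodMk (hx.comp_stronglyMeasurable hp.measurable.stronglyMeasurable))
  obtain ⟨K, hK⟩ := hbd (max u w)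
  obtain ⟨C, hC⟩ := (isCompact_Icc (a := p (min u w)) (b := p (max u w))).exists_bound_of_continuousOn
    hx.continuousOn
  refine (intervalIntegrable_const (c := K * C)).mono_fun hm.aestronglyMeasurable ?_
  filter_upwards [ae_restrict_mem measurableSet_uIoc] with v hv
  rw [uIoc, mem_Ioc] at hv
  refine (((B v).le_opNorm _).trans ?_).trans (le_abs_self _)
  exact mul_le_mul (hK v hv.2) (hC _ ⟨hp hv.1.le, hp hv.2⟩) (norm_nonneg _)
    ((norm_nonneg _).trans (hK v hv.2))

/-- Solvability of the linear Volterra equation with delay `p`. -/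
lemma exists_delay_solution [CompleteSpace E] {B : ℝ → E →L[ℝ] E} (hB : StronglyMeasurable B)
    (hbd : ∀ b, ∃ K, ∀ v ≤ b, ‖B v‖ ≤ K) {p : ℝ → ℝ} (hp : Monotone p) {a : ℝ}
    (hpv : ∀ v, a ≤ v → p v ≤ v) (hpa : ∀ v, a ≤ p v) (x₀ : E) :
    ∃ x : ℝ → E, Continuous x ∧ ∀ t, a ≤ t → x t = x₀ + ∫ v in a..t, B v (x (p v)) := by
  -- Clamping at `a` makes `G x` continuous on all of `ℝ` and constant to the left of `a`.
  set G : (ℝ → E) → ℝ → E := fun x t => ∫ v in a..(max t a), B v (x (p v)) with hG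
  have hGc : ∀ x, Continuous x → Continuous (G x) := fun x hx =>
    (intervalIntegral.continuous_primitive
      (fun u w => intervalIntegrable_delay hB hbd hp hx u w) a).comp (by fun_prop)
  -- The `X k` are the terms of the Neumann series, not its partial sums; the solution is `∑' k, X
  -- k`.
  set X : ℕ → ℝ → E := fun k => G^[k] fun _ => x₀ with hX
  have hXs : ∀ k, X (k + 1) = G (X k) := fun k => Function.iterate_succ_apply' _ _ _
  have hXc : ∀ k, Continuous (X k) := by
    intro k
    induction k with
    | zero => exact continuous_const
    | succ k ih => rw [hXs]; exact hGc _ ih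
  have hXb : ∀ b K, 0 ≤ K → (∀ v ≤ b, ‖B v‖ ≤ K) → ∀ k, ∀ t ∈ Icc a b,
      ‖X k t‖ ≤ ‖x₀‖ * ((K * (t - a)) ^ k / k.factorial) := by
    intro b K hK0 hK k
    induction k with
    | zero => intro t _; simp [hX]
    | succ k ih =>
      intro t ht
      rw [hXs]
      have hcont : Continuous fun v => K * (‖x₀‖ * ((K * (v - a)) ^ k / k.factorial)) := by
        fun_prop
      have h1 : ‖G (X k) t‖ ≤ ∫ v in a..t, K * (‖x₀‖ * ((K * (v - a)) ^ k / k.factorial)) := by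
        simp only [hG, max_eq_left ht.1]
        refine intervalIntegral.norm_integral_le_of_norm_le ht.1 (ae_of_all _ fun v hv => ?_)
          (hcont.intervalIntegrable _ _)
        refine ((B v).le_opNorm _).trans ?_
        have hpb := hpv v hv.1.le
        have hvb : v ≤ b := hv.2.trans ht.2
        refine mul_le_mul (hK v hvb) ((ih (p v) ⟨hpa v, hpb.trans hvb⟩).trans ?_)
          (norm_nonneg _) hK0
        -- The delay only helps: `p v ≤ v`, so the bound at `p v` is at most the bound at `v`, and
        -- the usual factorial estimate survives.
        have := sub_nonneg.2 (hpa v)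
        gcongr
      refine h1.trans_eq ?_
      have hder : ∀ v ∈ uIcc a t, HasDerivAt
          (fun v => ‖x₀‖ * ((K * (v - a)) ^ (k + 1) / (k + 1).factorial))
          (K * (‖x₀‖ * ((K * (v - a)) ^ k / k.factorial))) v := by
        intro v _
        have h := ((((hasDerivAt_id v).sub_const a).const_mul K).pow (k + 1)).div_const
          ((k + 1).factorial : ℝ) |>.const_mul ‖x₀‖
        refine h.congr_deriv ?_
        rw [Nat.factorial_succ]
        push_cast
        simp only [id]
        have : (k.factorial : ℝ) ≠ 0 := by positivity
        have : (k + 1 : ℝ) ≠ 0 := by positivity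
        field_simp
      rw [intervalIntegral.integral_eq_sub_of_hasDerivAt hder (hcont.intervalIntegrable _ _)]
      simp
  have hXa : ∀ k t, t ≤ a → X k t = X k a := by
    intro k t ht
    cases k with
    | zero => rfl
    | succ k => simp only [hXs, hG, max_eq_right ht, max_self]
  have hXb' : ∀ b, a ≤ b → ∃ K, 0 ≤ K ∧ (∀ v ≤ b, ‖B v‖ ≤ K) ∧ ∀ k, ∀ t ≤ b,
      ‖X k t‖ ≤ ‖x₀‖ * ((K * (b - a)) ^ k / k.factorial) := by
    intro b hab
    obtain ⟨K, hK⟩ := hbd b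
    have hK0 : 0 ≤ K := (norm_nonneg _).trans (hK b le_rfl)
    refine ⟨K, hK0, hK, fun k t ht => ?_⟩
    have main : ∀ t ∈ Icc a b, ‖X k t‖ ≤ ‖x₀‖ * ((K * (b - a)) ^ k / k.factorial) := by
      intro t ht
      refine (hXb b K hK0 hK k t ht).trans ?_
      have := sub_nonneg.2 ht.1
      have := ht.2
      gcongr
    rcases le_total a t with h | h
    · exact main t ⟨h, ht⟩
    · rw [hXa k t h]; exact main a ⟨le_rfl, hab⟩
  have hsum : ∀ c : ℝ, Summable fun k : ℕ => ‖x₀‖ * (c ^ k / k.factorial) := fun c =>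
    (Real.summable_pow_div_factorial c).mul_left _
  have hXsum : ∀ t, Summable fun k => X k t := by
    intro t
    obtain ⟨K, -, -, h⟩ := hXb' (max t a) (le_max_right _ _)
    exact Summable.of_norm_bounded (hsum _) fun k => h k t (le_max_left _ _)
  refine ⟨fun t => ∑' k, X k t, ?_, ?_⟩
  · refine continuous_iff_continuousAt.2 fun t => ?_
    obtain ⟨K, -, -, h⟩ := hXb' (max (t + 1) a) (le_max_right _ _)
    have : ContinuousOn (fun t => ∑' k, X k t) (Iio (t + 1)) :=
      continuousOn_tsum (fun k => (hXc k).continuousOn) (hsum _)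
        fun k s hs => h k s (hs.le.trans (le_max_left _ _))
    exact this.continuousAt (Iio_mem_nhds (by linarith))
  · intro t ht
    obtain ⟨K, hK0, hK, h⟩ := hXb' t ht
    have hS := intervalIntegral.hasSum_integral_of_dominated_convergence (a := a) (b := t)
      (μ := volume) (F := fun k v => B v (X k (p v))) (f := fun v => B v (∑' k, X k (p v)))
      (fun k _ => K * (‖x₀‖ * ((K * (t - a)) ^ k / k.factorial)))
      (fun k => (intervalIntegrable_iff.1
        (intervalIntegrable_delay hB hbd hp (hXc k) a t)).aestronglyMeasurable)
      (fun k => ae_of_all _ fun v hv => ?_)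
      (ae_of_all _ fun v _ => (hsum _).mul_left K)
      intervalIntegrable_const
      (ae_of_all _ fun v _ => (B v).hasSum (hXsum (p v)).hasSum)
    · simp only
      rw [(hXsum t).tsum_eq_zero_add]
      congr 1
      rw [← hS.tsum_eq]
      exact tsum_congr fun k => by simp only [hXs, hG, max_eq_left ht]
    · rw [uIoc_of_le ht] at hv
      exact ((B v).le_opNorm _).trans (mul_le_mul (hK v hv.2)
        (h k _ ((hpv v hv.1.le).trans hv.2)) (norm_nonneg _) hK0)

/-- The largest point of `T` which is at most `max v a`. -/
noncomputable def floorPoint (T : Set ℝ) (a v : ℝ) : ℝ := sSup (T ∩ Iic (max v a))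

section floorPoint

variable {T : Set ℝ} {a : ℝ}

lemma floorPoint_mem (hT : IsClosed T) (ha : a ∈ T) (v : ℝ) :
    floorPoint T a v ∈ T ∩ Iic (max v a) :=
  (hT.inter isClosed_Iic).csSup_mem ⟨a, ha, mem_Iic.2 (le_max_right v a)⟩ ⟨_, fun _ hs => hs.2⟩

lemma le_floorPoint {s v : ℝ} (hs : s ∈ T) (hsv : s ≤ max v a) : s ≤ floorPoint T a v :=
  le_csSup ⟨max v a, fun _ hs => hs.2⟩ ⟨hs, hsv⟩

lemma floorPoint_mono (hT : IsClosed T) (ha : a ∈ T) : Monotone (floorPoint T a) := by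
  intro u v huv
  have h := floorPoint_mem hT ha u
  exact le_floorPoint h.1 (h.2.trans (max_le_max_right a huv))

lemma floorPoint_le (hT : IsClosed T) (ha : a ∈ T) {v : ℝ} (hv : a ≤ v) : floorPoint T a v ≤ v :=
  (floorPoint_mem hT ha v).2.trans_eq (max_eq_left hv)

lemma floorPoint_of_mem (hT : IsClosed T) (ha : IsLeast T a) {t : ℝ} (ht : t ∈ T) :
    floorPoint T a t = t :=
  le_antisymm (floorPoint_le hT ha.1 (ha.2 ht)) (le_floorPoint ht (le_max_left _ _))

lemma floorPoint_of_gap (hT : IsClosed T) (ha : IsLeast T a) {t v : ℝ} (ht : t ∈ T)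
    (htv : t ≤ v) (hv : v < sigma T t) : floorPoint T a v = t := by
  refine le_antisymm ?_ (le_floorPoint ht (htv.trans (le_max_left _ _)))
  by_contra hn
  have h1 := floorPoint_le hT ha.1 ((ha.2 ht).trans htv)
  have h2 := sigma_le (floorPoint_mem hT ha.1 v).1 (not_le.1 hn)
  linarith

/-- The composite is continuous off a countable set: the jumps of the monotone map `floorPoint T a`
and the right-isolated points of `T`. Elsewhere either the floor is right-dense, where `A` is
continuous along `T`, or the floor is locally constant. -/
lemma stronglyMeasurable_comp_floorPoint {F : Type*} [TopologicalSpace F]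
    [TopologicalSpace.PseudoMetrizableSpace F] (hT : IsClosed T) (ha : IsLeast T a) {A : ℝ → F}
    (hA : ∀ t ∈ T, sigma T t = t → ContinuousWithinAt A T t) :
    StronglyMeasurable fun v => A (floorPoint T a v) := by
  refine StronglyMeasurable.of_countable_not_continuousAt
    (((floorPoint_mono hT ha.1).countable_not_continuousAt.union
      (countable_setOfPred_isolated_right_within (s := T))).mono fun u hu => ?_)
  by_contra hn
  simp only [mem_union, mem_ofPred_eq, not_or, not_not, not_and] at hn hu
  obtain ⟨hp, hiso⟩ := hn
  apply hu
  have hmem := floorPoint_mem hT ha.1 u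
  by_cases hσ : sigma T (floorPoint T a u) = floorPoint T a u
  · exact (hA _ hmem.1 hσ).tendsto.comp (tendsto_nhdsWithin_iff.2
      ⟨hp, Eventually.of_forall fun v => (floorPoint_mem hT ha.1 v).1⟩)
  have hlt : floorPoint T a u < sigma T (floorPoint T a u) :=
    lt_of_le_of_ne (le_sigma _ _) (Ne.symm hσ)
  suffices h : ∀ᶠ v in 𝓝 u, floorPoint T a v = floorPoint T a u by
    refine (continuousAt_const (y := A (floorPoint T a u))).congr ?_
    filter_upwards [h] with v hv
    rw [hv]
  have haf : a ≤ floorPoint T a u := ha.2 hmem.1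
  rcases lt_trichotomy u (floorPoint T a u) with h | h | h
  · have hua : u < a := by
      by_contra hn
      exact absurd (floorPoint_le hT ha.1 (not_lt.1 hn)) (not_le.2 h)
    have heq : ∀ v < a, floorPoint T a v = a := fun v hv =>
      le_antisymm ((floorPoint_mem hT ha.1 v).2.trans_eq (max_eq_right hv.le))
        (ha.2 (floorPoint_mem hT ha.1 v).1)
    filter_upwards [Iio_mem_nhds hua] with v hv
    rw [heq v hv, heq u hua]
  -- Here `u` itself is right-scattered, hence right-isolated in `T`, and was excluded.
  · refine absurd ?_ (hiso (h ▸ hmem.1))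
    rw [← h] at hlt
    rw [← empty_mem_iff_bot]
    have : Iio (sigma T u) ∈ 𝓝[T ∩ Ioi u] u := mem_nhdsWithin_of_mem_nhds (Iio_mem_nhds hlt)
    filter_upwards [this, self_mem_nhdsWithin] with v h1 h2
    exact absurd (sigma_le h2.1 h2.2) (not_le.2 h1)
  · have hu' : u < sigma T (floorPoint T a u) := by
      by_contra hn
      exact absurd (le_floorPoint (sigma_mem hT hmem.1)
        ((not_lt.1 hn).trans (le_max_left u a))) (not_le.2 hlt)
    filter_upwards [Ioo_mem_nhds h hu'] with v hv
    exact floorPoint_of_gap hT ha hmem.1 hv.1.le hv.2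

end floorPoint

/-- Existence for linear delta equations with right-dense continuous coefficients. -/
lemma exists_hasDeltaDerivVec [CompleteSpace E] {T : Set ℝ} (hT : IsClosed T) {t₀ : ℝ}
    (h₀ : IsLeast T t₀) {A : ℝ → E →L[ℝ] E}
    (hA : ∀ t ∈ T, ∃ K, ∀ᶠ s in 𝓝[T] t, ‖A s‖ ≤ K)
    (hAc : ∀ t ∈ T, sigma T t = t → ContinuousWithinAt A T t) (x₀ : E) :
    ∃ x : ℝ → E, x t₀ = x₀ ∧ ∀ t ∈ T, HasDeltaDerivVec T x (A t (x t)) t := by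
  set p := floorPoint T t₀ with hp
  have hpm : Monotone p := floorPoint_mono hT h₀.1
  have hpT : ∀ v, p v ∈ T := fun v => (floorPoint_mem hT h₀.1 v).1
  have hple : ∀ v, t₀ ≤ v → p v ≤ v := fun v hv => floorPoint_le hT h₀.1 hv
  have hpt : ∀ t ∈ T, p t = t := fun t ht => floorPoint_of_mem hT h₀ ht
  have hB : StronglyMeasurable fun v => A (p v) := stronglyMeasurable_comp_floorPoint hT h₀ hAc
  have hbd : ∀ b, ∃ K, ∀ v ≤ b, ‖A (p v)‖ ≤ K := fun b => by
    obtain ⟨K, -, hK⟩ := exists_bound_of_locally_bounded hT hA t₀ (max b t₀)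
    exact ⟨K, fun v hv => hK _ (hpT v) ⟨h₀.2 (hpT v), (floorPoint_mem hT h₀.1 v).2.trans
      (max_le_max_right _ hv)⟩⟩
  obtain ⟨x, hxc, hx⟩ := exists_delay_solution hB hbd hpm hple (fun v => h₀.2 (hpT v)) x₀
  refine ⟨x, by simpa using hx t₀ le_rfl, ?_⟩
  set h : ℝ → E := fun s => A s (x s) with hh
  have hint : ∀ u w, IntervalIntegrable (fun v => h (p v)) volume u w :=
    fun u w => intervalIntegrable_delay hB hbd hpm hxc u w
  -- The differentiation error is an integral of `h ∘ p - c`, so only the size of that integrand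
  -- matters.
  have hdiff : ∀ s ∈ T, ∀ t ∈ T, ∀ c : E,
      x t - x s - (t - s) • c = ∫ v in s..t, (h (p v) - c) := by
    intro s hs t ht c
    rw [intervalIntegral.integral_sub (hint s t) intervalIntegrable_const,
      intervalIntegral.integral_const, hx s (h₀.2 hs), hx t (h₀.2 ht),
      add_sub_add_left_eq_sub, intervalIntegral.integral_interval_sub_left (hint _ _) (hint _ _)]
  intro t ht ε hε
  rcases (le_sigma T t).eq_or_lt with hσ | hσ
  · have hhc : ContinuousWithinAt h T t :=
      (hAc t ht hσ.symm).clm_apply hxc.continuousWithinAt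
    obtain ⟨δ, hδ, H⟩ := Metric.continuousWithinAt_iff.1 hhc ε hε
    refine ⟨δ, hδ, fun s hs hst => ?_⟩
    rw [← hσ, hdiff s hs t ht]
    refine intervalIntegral.norm_integral_le_of_norm_le_const fun v hv => ?_
    rw [← dist_eq_norm]
    refine (H (hpT v) ?_).le
    rw [uIoc, mem_Ioc] at hv
    -- Since `s` and `t` lie in `T`, the floor of a point between them stays between them, where `h`
    -- is close to `h t`.
    have h1 : min s t ≤ p v := by
      rcases min_choice s t with e | e <;> rw [e] at hv ⊢
      · exact le_floorPoint hs (hv.1.le.trans (le_max_left _ _))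
      · exact le_floorPoint ht (hv.1.le.trans (le_max_left _ _))
    have h2 : p v ≤ max s t := (hple v ((le_min (h₀.2 hs) (h₀.2 ht)).trans hv.1.le)).trans hv.2
    rw [Real.dist_eq, abs_lt]
    rw [abs_lt] at hst
    constructor
    · rcases min_choice s t with e | e <;> rw [e] at h1 <;> linarith
    · rcases max_choice s t with e | e <;> rw [e] at h2 <;> linarith
  · obtain ⟨C, hC⟩ : ∃ C, ∀ v ∈ Icc t₀ t, ‖h (p v) - h t‖ ≤ C := by
      obtain ⟨K, hK⟩ := hbd t
      obtain ⟨M, hM⟩ := (isCompact_Icc (a := t₀) (b := t)).exists_bound_of_continuousOn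
        hxc.continuousOn
      refine ⟨K * M + ‖h t‖, fun v hv => (norm_sub_le _ _).trans (add_le_add_left ?_ _)⟩
      exact ((A _).le_opNorm _).trans (mul_le_mul (hK v hv.2)
        (hM _ ⟨h₀.2 (hpT v), (hple v hv.1).trans hv.2⟩) (norm_nonneg _)
        ((norm_nonneg _).trans (hK v hv.2)))
    have hC0 : 0 ≤ C := (norm_nonneg _).trans (hC t ⟨h₀.2 ht, le_rfl⟩)
    set σ := sigma T t with hσdef
    have hσT : σ ∈ T := sigma_mem hT ht
    have hpos : 0 < σ - t := sub_pos.2 hσ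
    -- The first radius forces `s ≤ t`. The second makes `C * |t - s|` at most `ε * (σ - t)`, hence
    -- at most `ε * (σ - s)`.
    refine ⟨min (σ - t) (ε * (σ - t) / (C + 1)), by positivity, fun s hs hst => ?_⟩
    have hst1 := hst.trans_le (min_le_left _ _)
    have hst2 := hst.trans_le (min_le_right _ _)
    have hle : s ≤ t := by
      by_contra hn
      have := sigma_le hs (not_le.1 hn)
      rw [abs_of_pos (by linarith)] at hst1
      linarith
    rw [hdiff s hs σ hσT, ← intervalIntegral.integral_add_adjacent_intervals
      ((hint s t).sub intervalIntegrable_const) ((hint t σ).sub intervalIntegrable_const)]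
    -- On the gap the floor is `t`, except at the null endpoint `σ`.
    have hz : ∫ v in t..σ, (h (p v) - h t) = 0 := by
      refine intervalIntegral.integral_zero_ae ?_
      filter_upwards [compl_mem_ae_iff.2 (measure_singleton (μ := volume) σ)] with v hv hvI
      rw [uIoc_of_le hσ.le] at hvI
      rw [hp, floorPoint_of_gap hT h₀ ht hvI.1.le (lt_of_le_of_ne hvI.2 hv), sub_self]
    rw [hz, add_zero]
    have h1 : ‖∫ v in s..t, (h (p v) - h t)‖ ≤ C * |t - s| := by
      refine intervalIntegral.norm_integral_le_of_norm_le_const fun v hv => ?_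
      rw [uIoc_of_le hle] at hv
      exact hC v ⟨(h₀.2 hs).trans hv.1.le, hv.2⟩
    refine h1.trans ?_
    rw [abs_sub_comm, abs_of_pos (show 0 < σ - s by linarith)]
    rw [lt_div_iff₀ (by positivity)] at hst2
    have := abs_nonneg (s - t)
    nlinarith

end general

/-! ### Coordinates, linear images and reflection -/

section conversions

variable {E F : Type*} [NormedAddCommGroup E] [NormedSpace ℝ E] [NormedAddCommGroup F]
  [NormedSpace ℝ F]

lemma hasDeltaDerivVec_real {T : Set ℝ} {f : ℝ → ℝ} {a t : ℝ} :
    HasDeltaDerivVec T f a t ↔ HasDeltaDeriv T f a t := by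
  simp only [HasDeltaDerivVec, HasDeltaDeriv, smul_eq_mul, Real.norm_eq_abs, mul_comm a]

lemma HasDeltaDerivVec.clm_comp {T : Set ℝ} {f : ℝ → E} {a : E} {t : ℝ}
    (h : HasDeltaDerivVec T f a t) (φ : E →L[ℝ] F) :
    HasDeltaDerivVec T (fun s => φ (f s)) (φ a) t := by
  intro ε hε
  obtain ⟨δ, hδ, H⟩ := h (ε / (‖φ‖ + 1)) (by positivity)
  refine ⟨δ, hδ, fun s hs hst => ?_⟩
  rw [← map_sub, ← map_smul, ← map_sub]
  refine (φ.le_opNorm _).trans ?_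
  refine (mul_le_mul_of_nonneg_left (H s hs hst) (norm_nonneg φ)).trans ?_
  rw [← mul_assoc]
  refine mul_le_mul_of_nonneg_right ?_ (abs_nonneg _)
  rw [mul_div_assoc', div_le_iff₀ (by positivity)]
  nlinarith

lemma hasDeltaDerivVec_pi {ι : Type*} [Fintype ι] {T : Set ℝ} {f : ℝ → ι → E} {a : ι → E}
    {t : ℝ} : HasDeltaDerivVec T f a t ↔ ∀ i, HasDeltaDerivVec T (fun s => f s i) (a i) t := by
  constructor
  · exact fun h i => h.clm_comp (ContinuousLinearMap.proj (R := ℝ) (φ := fun _ : ι => E) i)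
  · intro h ε hε
    choose δ hδ H using fun i => h i ε hε
    obtain ⟨d, hd, hdle⟩ : ∃ d > 0, ∀ i, d ≤ δ i := by
      rcases isEmpty_or_nonempty ι with hι | hι
      · exact ⟨1, one_pos, fun i => hι.elim i⟩
      · obtain ⟨i, hi⟩ := Finite.exists_min δ
        exact ⟨δ i, hδ i, hi⟩
    refine ⟨d, hd, fun s hs hst => ?_⟩
    rw [pi_norm_le_iff_of_nonneg (by positivity)]
    exact fun i => H i s hs (hst.trans_le (hdle i))

lemma hasNablaDeriv_iff_dual {S : Set ℝ} {f : ℝ → ℝ} {a s : ℝ} :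
    HasNablaDeriv S f a s ↔ HasDeltaDeriv (dual S) (fun t => f (-t)) (-a) (-s) := by
  unfold HasNablaDeriv HasDeltaDeriv
  rw [sigma_neg_dual]
  simp only [neg_neg]
  refine forall₂_congr fun ε _ => exists_congr fun δ => and_congr_right fun _ => ?_
  have e1 : ∀ r, |(-r) - s| = |r - -s| := fun r => by
    rw [← abs_neg]; congr 1; ring
  have e2 : ∀ r, |rho S s - -r| = |-rho S s - r| := fun r => by
    rw [← abs_neg]; congr 1; ring
  have e3 : ∀ r, a * (rho S s - -r) = -a * (-rho S s - r) := fun r => by ring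
  constructor
  · intro H r hr hrs
    have := H (-r) hr (by rwa [e1])
    rwa [e2, e3] at this
  · intro H r hr hrs
    have := H (-r) (by simpa [dual] using hr) (by rwa [← e1, neg_neg])
    rwa [← e2, ← e3, neg_neg] at this

end conversions

/-! ### Removed endpoints and ld-continuity -/

section kappa

variable {F : Type*}

lemma isGreatest_dual_neg {S : Set ℝ} {s : ℝ} : IsGreatest (dual S) (-s) ↔ IsLeast S s := by
  constructor
  · exact fun h => ⟨by simpa [dual] using h.1, fun r hr =>
      neg_le_neg_iff.1 (h.2 (show - -r ∈ S by rwa [neg_neg]))⟩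
  · exact fun h => ⟨show - -s ∈ S by simpa using h.1, fun r hr => le_neg.2 (h.2 hr)⟩

lemma neg_mem_upperKappa_dual {S : Set ℝ} {s : ℝ} :
    -s ∈ upperKappa (dual S) ↔ s ∈ lowerKappa S := by
  have h : -s ∈ dual S ↔ s ∈ S := by simp [dual]
  simp only [upperKappa, lowerKappa, mem_ofPred_eq, h, isGreatest_dual_neg, rho_neg_dual,
    neg_lt_neg_iff]

lemma nhdsWithin_le_pure_of_notMem_lowerKappa {S : Set ℝ} {s : ℝ} (hs : s ∈ S)
    (h : s ∉ lowerKappa S) : 𝓝[S] s ≤ pure s := by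
  have h' : IsLeast S s ∧ s < sigma S s := by
    by_contra hn
    exact h ⟨hs, hn⟩
  have : Iio (sigma S s) ∈ 𝓝[S] s := mem_nhdsWithin_of_mem_nhds (Iio_mem_nhds h'.2)
  rw [le_pure_iff]
  filter_upwards [this, self_mem_nhdsWithin] with v h1 h2
  rcases (h'.1.2 h2).eq_or_lt with e | e
  · exact e.symm
  · exact absurd (sigma_le h2 e) (not_le.2 h1)

lemma nhdsWithin_lowerKappa {S : Set ℝ} {s : ℝ} (h : s ∈ lowerKappa S) :
    𝓝[lowerKappa S] s = 𝓝[S] s := by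
  refine le_antisymm (nhdsWithin_mono _ fun _ hr => hr.1) ?_
  refine nhdsWithin_le_iff.2 ?_
  by_cases hS : S ⊆ lowerKappa S
  · exact mem_of_superset self_mem_nhdsWithin hS
  · obtain ⟨m, hm, hmk⟩ := not_subset.1 hS
    have hms : s ∈ ({m} : Set ℝ)ᶜ := fun e => hmk (e ▸ h)
    have : ({m} : Set ℝ)ᶜ ∈ 𝓝[S] s :=
      mem_nhdsWithin_of_mem_nhds (isOpen_compl_singleton.mem_nhds hms)
    filter_upwards [this, self_mem_nhdsWithin] with v h1 h2
    refine ⟨h2, fun hv => h1 ?_⟩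
    have hml : IsLeast S m := by
      by_contra hn
      exact hmk ⟨hm, fun h => hn h.1⟩
    exact hv.1.unique hml

/-- A removed minimum is isolated in `S`, so continuity there is automatic and `lowerKappa S` can be
replaced by `S`. -/
lemma IsLdContinuous.continuousWithinAt [TopologicalSpace F] {S : Set ℝ} {A : ℝ → F}
    (hA : IsLdContinuous S A) {s : ℝ} (hs : s ∈ S) (hρ : rho S s = s) :
    ContinuousWithinAt A S s := by
  by_cases h : s ∈ lowerKappa S
  · have := (hA s h).1 hρ
    rwa [ContinuousWithinAt, nhdsWithin_lowerKappa h] at this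
  · exact (tendsto_pure_nhds A s).mono_left (nhdsWithin_le_pure_of_notMem_lowerKappa hs h)

lemma le_rho {S : Set ℝ} {r s : ℝ} (hr : r ∈ S) (hrs : r < s) : r ≤ rho S s := by
  rw [rho, if_pos ⟨r, hr, hrs⟩]
  exact le_csSup ⟨s, fun v hv => hv.2.le⟩ ⟨hr, hrs⟩

lemma rho_le (S : Set ℝ) (s : ℝ) : rho S s ≤ s := by
  unfold rho
  split_ifs with h
  · exact csSup_le h fun r hr => hr.2.le
  · exact le_rfl

lemma IsLdContinuous.locally_bounded [SeminormedAddCommGroup F] {S : Set ℝ} {A : ℝ → F}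
    (hA : IsLdContinuous S A) {s : ℝ} (hs : s ∈ S) : ∃ K, ∀ᶠ r in 𝓝[S] s, ‖A r‖ ≤ K := by
  by_cases h : s ∈ lowerKappa S
  swap
  · exact ⟨‖A s‖, nhdsWithin_le_pure_of_notMem_lowerKappa hs h
      (eventually_pure.2 le_rfl : ∀ᶠ r in pure s, ‖A r‖ ≤ ‖A s‖)⟩
  have of_tendsto : ∀ {l : Filter ℝ} {c : F}, Tendsto A l (𝓝 c) → ∃ K, ∀ᶠ r in l, ‖A r‖ ≤ K :=
    fun {l c} hl => ⟨‖c‖ + 1, (hl.norm.eventually_lt_const (lt_add_one _)).mono fun _ h => h.le⟩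
  rcases (rho_le S s).eq_or_lt with hρ | hρ
  · exact of_tendsto (hA.continuousWithinAt hs hρ)
  -- At a left-scattered point only the right side matters: a right limit bounds `A` if `s` is
  -- right-dense; otherwise there are no nearby points.
  have right : ∃ K, ∀ᶠ r in 𝓝[S ∩ Ioi s] s, ‖A r‖ ≤ K := by
    rcases (le_sigma S s).eq_or_lt with hσ | hσ
    · obtain ⟨c, hc⟩ := (hA s h).2 hσ.symm
      rw [nhdsWithin_inter, nhdsWithin_lowerKappa h, ← nhdsWithin_inter] at hc
      exact of_tendsto hc
    · refine ⟨0, ?_⟩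
      have : Iio (sigma S s) ∈ 𝓝[S ∩ Ioi s] s := mem_nhdsWithin_of_mem_nhds (Iio_mem_nhds hσ)
      filter_upwards [this, self_mem_nhdsWithin] with v h1 h2
      exact absurd (sigma_le h2.1 h2.2) (not_le.2 h1)
  obtain ⟨K, hK⟩ := right
  refine ⟨max K ‖A s‖, ?_⟩
  have hK' := eventually_nhdsWithin_iff.1 hK
  filter_upwards [mem_nhdsWithin_of_mem_nhds (Ioi_mem_nhds hρ),
    mem_nhdsWithin_of_mem_nhds hK', self_mem_nhdsWithin] with v h1 h2 h3
  rcases lt_trichotomy v s with e | e | e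
  · exact absurd (le_rho h3 e) (not_le.2 h1)
  · rw [e]; exact le_max_right _ _
  · exact (h2 ⟨h3, e⟩).trans (le_max_left _ _)

lemma IsLdContinuous.comp_continuous {F' : Type*} [TopologicalSpace F] [TopologicalSpace F']
    {S : Set ℝ} {A : ℝ → F} (hA : IsLdContinuous S A) {g : F → F'} (hg : Continuous g) :
    IsLdContinuous S fun s => g (A s) := fun s hs =>
  ⟨fun h => hg.continuousAt.comp_continuousWithinAt ((hA s hs).1 h), fun h => by
    obtain ⟨c, hc⟩ := (hA s hs).2 h
    exact ⟨g c, (hg.tendsto c).comp hc⟩⟩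

lemma tendsto_neg_dual (S : Set ℝ) (t : ℝ) : Tendsto (fun r : ℝ => -r) (𝓝[dual S] t) (𝓝[S] (-t)) :=
  tendsto_nhdsWithin_iff.2 ⟨continuous_neg.continuousAt.mono_left nhdsWithin_le_nhds,
    eventually_mem_nhdsWithin⟩

/-- A removed maximum is isolated and its own forward jump, so the estimate reads `0 ≤ 0`. Hence the
equation may be imposed at all points without changing the solutions. -/
lemma hasDeltaDeriv_of_notMem_upperKappa {T : Set ℝ} {t₀ t : ℝ} (ht : t ∈ T) (h₀ : t₀ ≤ t)
    (h : t ∉ upperKappa T) (f : ℝ → ℝ) (a : ℝ) : HasDeltaDeriv (T ∩ Ici t₀) f a t := by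
  have h' : IsGreatest T t ∧ rho T t < t := by
    by_contra hn
    exact h ⟨ht, hn⟩
  have hσ : sigma T t = t := by
    rw [sigma, if_neg]
    rintro ⟨s, hs, hts⟩
    exact absurd (h'.1.2 hs) (not_le.2 hts)
  intro ε hε
  refine ⟨t - rho T t, sub_pos.2 h'.2, fun s hs hst => ?_⟩
  have : s = t := by
    rcases (h'.1.2 hs.1).eq_or_lt with e | e
    · exact e
    · have := le_rho hs.1 e
      rw [abs_of_neg (by linarith)] at hst
      linarith
  rw [sigma_inter_Ici T h₀, hσ, this]
  simp

end kappa

/-! ### Well-posedness of the reflected equation -/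

section wellPosed

variable {E : Type*} [NormedAddCommGroup E] [NormedSpace ℝ E]

lemma isLeast_dual_inter_Ici {S : Set ℝ} {s₀ : ℝ} (hs₀ : s₀ ∈ S) :
    IsLeast (dual S ∩ Ici (-s₀)) (-s₀) :=
  ⟨⟨show - -s₀ ∈ S by rwa [neg_neg], self_mem_Ici⟩, fun _ h => h.2⟩

lemma isClosed_dual_inter_Ici {S : Set ℝ} (hS : IsClosed S) (s₀ : ℝ) :
    IsClosed (dual S ∩ Ici (-s₀)) :=
  (hS.preimage continuous_neg).inter isClosed_Ici

lemma dual_locally_bounded {S : Set ℝ} {A : ℝ → E →L[ℝ] E} (hA : IsLdContinuous S A) (s₀ : ℝ) :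
    ∀ t ∈ dual S ∩ Ici (-s₀), ∃ K, ∀ᶠ r in 𝓝[dual S ∩ Ici (-s₀)] t, ‖A (-r)‖ ≤ K := by
  intro t ht
  obtain ⟨K, hK⟩ := hA.locally_bounded (s := -t) ht.1
  exact ⟨K, ((tendsto_neg_dual S t).eventually hK).filter_mono
    (nhdsWithin_mono _ inter_subset_left)⟩

lemma exists_dual_solution [CompleteSpace E] {S : Set ℝ} (hS : IsClosed S) {s₀ : ℝ} (hs₀ : s₀ ∈ S)
    {A : ℝ → E →L[ℝ] E} (hA : IsLdContinuous S A) (x₀ : E) :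
    ∃ x : ℝ → E, x (-s₀) = x₀ ∧ ∀ t ∈ dual S ∩ Ici (-s₀),
      HasDeltaDerivVec (dual S ∩ Ici (-s₀)) x (A (-t) (x t)) t := by
  refine exists_hasDeltaDerivVec (A := fun t => A (-t)) (isClosed_dual_inter_Ici hS s₀)
    (isLeast_dual_inter_Ici hs₀) (dual_locally_bounded hA s₀) (fun t ht hσ => ?_) x₀
  rw [sigma_inter_Ici _ ht.2] at hσ
  have hρ : rho S (-t) = -t := by
    have := sigma_neg_dual S (-t)
    rw [neg_neg, hσ] at this
    linarith
  have hc : Tendsto A (𝓝[S] (-t)) (𝓝 (A (-t))) := hA.continuousWithinAt ht.1 hρ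
  exact (hc.comp (tendsto_neg_dual S t)).mono_left (nhdsWithin_mono _ inter_subset_left)

lemma dual_solution_unique {S : Set ℝ} (hS : IsClosed S) {s₀ : ℝ} (hs₀ : s₀ ∈ S)
    {A : ℝ → E →L[ℝ] E} (hA : IsLdContinuous S A) {x y : ℝ → E} (h₀ : x (-s₀) = y (-s₀))
    (hx : ∀ t ∈ dual S ∩ Ici (-s₀), HasDeltaDerivVec (dual S ∩ Ici (-s₀)) x (A (-t) (x t)) t)
    (hy : ∀ t ∈ dual S ∩ Ici (-s₀), HasDeltaDerivVec (dual S ∩ Ici (-s₀)) y (A (-t) (y t)) t)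
    {t : ℝ} (ht : t ∈ dual S ∩ Ici (-s₀)) : x t = y t := by
  refine sub_eq_zero.1 (eq_zero_of_hasDeltaDerivVec (z := fun t => x t - y t)
    (isClosed_dual_inter_Ici hS s₀) (isLeast_dual_inter_Ici hs₀) (dual_locally_bounded hA s₀)
    (sub_eq_zero.2 h₀) (fun t ht => ?_) ht)
  rw [map_sub]
  exact (hx t ht).sub (hy t ht)

end wellPosed

/-! ### Matrix and vector systems as operator equations -/

section matrix

variable {n : ℕ}

/-- A matrix acting on square matrices by left multiplication. -/
noncomputable def leftMulCLM :
    Matrix (Fin n) (Fin n) ℝ →ₗ[ℝ] ((Fin n → Fin n → ℝ) →L[ℝ] (Fin n → Fin n → ℝ)) where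
  toFun M := LinearMap.toContinuousLinearMap
    { toFun := fun X => (M * Matrix.of X : Matrix (Fin n) (Fin n) ℝ)
      map_add' := fun X Y => Matrix.mul_add M X Y
      map_smul' := fun c X => Matrix.mul_smul M c X }
  map_add' M N := by ext1 X; exact Matrix.add_mul M N X
  map_smul' c M := by ext1 X; exact Matrix.smul_mul c M X

/-- A matrix acting on vectors. -/
noncomputable def mulVecCLM :
    Matrix (Fin n) (Fin n) ℝ →ₗ[ℝ] ((Fin n → ℝ) →L[ℝ] (Fin n → ℝ)) where
  toFun M := LinearMap.toContinuousLinearMap (Matrix.mulVecLin M)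
  map_add' M N := by ext1 v; exact Matrix.add_mulVec M N v
  map_smul' c M := by ext1 v; exact Matrix.smul_mulVec c M v

/-- Evaluation of a matrix at a fixed vector. -/
noncomputable def mulVecRightCLM (v : Fin n → ℝ) : (Fin n → Fin n → ℝ) →L[ℝ] (Fin n → ℝ) :=
  LinearMap.toContinuousLinearMap
    { toFun := fun X => (Matrix.of X).mulVec v
      map_add' := fun X Y => Matrix.add_mulVec X Y v
      map_smul' := fun c X => Matrix.smul_mulVec c X v }

/-- Viewing matrices as `Fin n → Fin n → ℝ` supplies the sup norm, for which vector-valued and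
entrywise differentiability agree. -/
lemma isForwardFundamental_iff {S : Set ℝ} {B : ℝ → Matrix (Fin n) (Fin n) ℝ} {s₀ : ℝ}
    {X : ℝ → Matrix (Fin n) (Fin n) ℝ} :
    IsForwardFundamental (dual S) (-dualFun B) (-s₀) X ↔ X (-s₀) = 1 ∧
      ∀ t ∈ dual S ∩ Ici (-s₀), HasDeltaDerivVec (E := Fin n → Fin n → ℝ)
        (dual S ∩ Ici (-s₀)) X (leftMulCLM (-B (-t)) (X t)) t := by
  refine and_congr_right fun _ => ?_
  have hpi : ∀ t, HasDeltaDerivVec (E := Fin n → Fin n → ℝ) (dual S ∩ Ici (-s₀)) X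
      (leftMulCLM (-B (-t)) (X t)) t ↔ ∀ i j, HasDeltaDeriv (dual S ∩ Ici (-s₀))
        (fun τ => X τ i j) (((-dualFun B) t * X t) i j) t := fun t =>
    hasDeltaDerivVec_pi.trans (forall_congr' fun i =>
      hasDeltaDerivVec_pi.trans (forall_congr' fun j => hasDeltaDerivVec_real))
  simp only [hpi]
  constructor
  · intro h t ht i j
    by_cases hk : t ∈ upperKappa (dual S)
    · exact h t hk ht.2 i j
    · exact hasDeltaDeriv_of_notMem_upperKappa ht.1 ht.2 hk _ _
  · exact fun h t hk ht i j => h t ⟨hk.1, ht⟩ i j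

lemma isBackwardSolution_iff {S : Set ℝ} {B : ℝ → Matrix (Fin n) (Fin n) ℝ} {s₀ : ℝ}
    {y₀ : Fin n → ℝ} {y : ℝ → Fin n → ℝ} :
    IsBackwardSolution S B s₀ y₀ y ↔ y s₀ = y₀ ∧
      ∀ t ∈ dual S ∩ Ici (-s₀), HasDeltaDerivVec (dual S ∩ Ici (-s₀)) (fun r => y (-r))
        (mulVecCLM (-B (-t)) (y (-t))) t := by
  refine and_congr_right fun _ => ?_
  have hd : dual (S ∩ Iic s₀) = dual S ∩ Ici (-s₀) := by
    ext t
    simp only [dual, mem_ofPred_eq, mem_inter_iff, mem_Iic, mem_Ici, neg_le]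
  simp only [hasDeltaDerivVec_pi, hasDeltaDerivVec_real, hasNablaDeriv_iff_dual, hd]
  have hval : ∀ s i, mulVecCLM (-B s) (y s) i = -((B s).mulVec (y s) i) := fun s i =>
    congrFun (Matrix.neg_mulVec (y s) (B s)) i
  simp only [hval]
  constructor
  · intro h t ht i
    by_cases hk : t ∈ upperKappa (dual S)
    · have := h (-t) (neg_mem_upperKappa_dual.1 (by rwa [neg_neg])) (neg_le.1 ht.2) i
      rwa [neg_neg] at this
    · exact hasDeltaDeriv_of_notMem_upperKappa ht.1 ht.2 hk _ _
  · intro h s hk hs i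
    have := h (-s) ⟨show - -s ∈ S by simpa using hk.1, neg_le_neg hs⟩ i
    rwa [neg_neg] at this

end matrix

end TScale

open TScale in
theorem proposition3p1 {n : ℕ} (Tstar : Set ℝ) (hT : TScale.IsTimeScale Tstar)
    (Abar : ℝ → Matrix (Fin n) (Fin n) ℝ) (hA : TScale.IsLdContinuous Tstar Abar)
    (s₀ : ℝ) (hs₀ : s₀ ∈ Tstar) (y₀ : Fin n → ℝ) :
    -- the transition function `Φ` of the dual delta system is well defined
    (TScale.IsForwardFundamental (TScale.dual Tstar) (-TScale.dualFun Abar) (-s₀)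
        (fun t => TScale.transition (TScale.dual Tstar) (-TScale.dualFun Abar) t (-s₀)) ∧
      ∀ X, TScale.IsForwardFundamental (TScale.dual Tstar) (-TScale.dualFun Abar) (-s₀) X →
        ∀ t ∈ TScale.dual Tstar, -s₀ ≤ t →
          X t = TScale.transition (TScale.dual Tstar) (-TScale.dualFun Abar) t (-s₀)) ∧
    -- there is a unique backward solution, given by the dual transition function `Ψ`
    ∃ y : ℝ → Fin n → ℝ,
      TScale.IsBackwardSolution Tstar Abar s₀ y₀ y ∧
      (∀ z, TScale.IsBackwardSolution Tstar Abar s₀ y₀ z →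
        ∀ s ∈ Tstar, s ≤ s₀ → z s = y s) ∧
      ∀ s ∈ Tstar, s ≤ s₀ → y s = (TScale.dualTransition Tstar Abar s s₀).mulVec y₀ := by
  have hM : IsLdContinuous Tstar fun s => leftMulCLM (-Abar s) := hA.comp_continuous
    ((LinearMap.continuous_of_finiteDimensional leftMulCLM).comp continuous_neg)
  have hV : IsLdContinuous Tstar fun s => mulVecCLM (-Abar s) := hA.comp_continuous
    ((LinearMap.continuous_of_finiteDimensional mulVecCLM).comp continuous_neg)
  have hex : ∃ X, IsForwardFundamental (dual Tstar) (-dualFun Abar) (-s₀) X := by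
    obtain ⟨X, hX₀, hX⟩ := exists_dual_solution hT.2 hs₀ hM (1 : Matrix (Fin n) (Fin n) ℝ)
    exact ⟨X, isForwardFundamental_iff.2 ⟨hX₀, hX⟩⟩
  -- The chosen function does not depend on `t`, so the pointwise values of `transition` assemble
  -- into one solution.
  have hΦ : IsForwardFundamental (dual Tstar) (-dualFun Abar) (-s₀)
      (fun t => transition (dual Tstar) (-dualFun Abar) t (-s₀)) := Classical.epsilon_spec hex
  obtain ⟨hΦ₀, hΦ'⟩ := isForwardFundamental_iff.1 hΦ
  -- Evaluation at `y₀` intertwines left multiplication with the action on vectors, carrying the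
  -- matrix equation to the vector one.
  have hcomp : ∀ M X : Matrix (Fin n) (Fin n) ℝ,
      mulVecRightCLM y₀ (leftMulCLM M X) = mulVecCLM M (X.mulVec y₀) := fun M X =>
    (Matrix.mulVec_mulVec y₀ M X).symm
  have hy : IsBackwardSolution Tstar Abar s₀ y₀
      (fun s => (dualTransition Tstar Abar s s₀).mulVec y₀) := by
    refine isBackwardSolution_iff.2 ⟨?_, fun t ht => ?_⟩
    · change (transition (dual Tstar) (-dualFun Abar) (-s₀) (-s₀)).mulVec y₀ = y₀
      rw [hΦ₀, Matrix.one_mulVec]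
    · have h := (hΦ' t ht).clm_comp (mulVecRightCLM y₀)
      rw [hcomp] at h
      simp only [dualTransition, neg_neg]
      exact h
  refine ⟨⟨hΦ, fun X hX t ht h => ?_⟩, _, hy, fun z hz s hs hss => ?_, fun s _ _ => rfl⟩
  · obtain ⟨hX₀, hX'⟩ := isForwardFundamental_iff.1 hX
    exact dual_solution_unique hT.2 hs₀ hM
      (y := fun t => transition (dual Tstar) (-dualFun Abar) t (-s₀))
      (hX₀.trans hΦ₀.symm) hX' hΦ' ⟨ht, h⟩
  · obtain ⟨hy₀, hy'⟩ := isBackwardSolution_iff.1 hy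
    obtain ⟨hz₀, hz'⟩ := isBackwardSolution_iff.1 hz
    have := dual_solution_unique hT.2 hs₀ hV (t := -s) (x := fun r => z (-r))
      (y := fun r => (dualTransition Tstar Abar (-r) s₀).mulVec y₀)
      (by simp only [neg_neg]; exact hz₀.trans hy₀.symm) hz' hy'
      ⟨show - -s ∈ Tstar by rwa [neg_neg], neg_le_neg hss⟩
    simpa only [neg_neg] using this
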